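/- Let $p$ be a prime, let $m \ge 2$ be an integer, and let $\delta, \nu, \epsilon > 0$ be real numbers. View $\{0,1\}^n$ as a subset of $\mathbb{F}_p^n$, and call a linear form $\phi : \mathbb{F}_p^n \to \mathbb{F}_p$ a mod-$p$ form. For non-empty subsets $\mathcal{B}_1, \dots, \mathcal{B}_m$ of $\{0,1\}^n$ and a mod-$p$ form $\phi$, define the correlation \[ \mathrm{cor}_{\mathcal{B}_1, \dots, \mathcal{B}_m} \phi = \Big( \sum_{y \in \mathbb{F}_p} \prod_{t=1}^m \mathbb{P}_{x \in \mathcal{B}_t}[\phi(x) = y] \Big) - \frac{1}{p^{m-1}}, \] where $\mathbb{P}_{x \in \mathcal{B}}$ denotes the probability when $x$ is chosen uniformly at random in $\mathcal{B}$. Then there exists a real number $C = C(\delta, \nu, \epsilon, p, m) > 0$ such that the following holds for all non-negative integers $n$ and all positive integers $s$. If $\mathcal{A}_1, \dots, \mathcal{A}_s$ are (not necessarily distinct) non-empty subsets of $\{0,1\}^n$, each with density $|\mathcal{A}_i|/2^n$ at least $\delta$, then there exists a subset $R$ of $[s] = \{1, \dots, s\}$ with $|R| \ge s/(n+1)^{C}$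 such that for at least $(1-\epsilon)|R|^m$ of the $m$-tuples $(i_1, \dots, i_m) \in R^m$ we have \[ \mathrm{cor}_{\mathcal{A}_{i_1}, \dots, \mathcal{A}_{i_m}} \phi \ge -\nu \] for every mod-$p$ form $\phi : \mathbb{F}_p^n \to \mathbb{F}_p$. -/

import Mathlib

/-- The discrete cube `{0,1}^n`. -/
abbrev Cube (n : ℕ) : Type := Fin n → Fin 2

/-- The inclusion of `{0,1}^n` into `𝔽_p^n`. -/
def Cube.toZMod (p : ℕ) {n : ℕ} (x : Cube n) : Fin n → ZMod p :=
  fun z => ((x z : ℕ) : ZMod p)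

/-- A mod-`p` linear form in `n` variables. -/
abbrev ModForm (p n : ℕ) : Type := (Fin n → ZMod p) →ₗ[ZMod p] ZMod p

/-- The distribution of `F x` for `x` uniform in the (non-empty) finite set `A`, given by its
point masses: `d ↦ ℙ_{x ∈ A}[F x = d]`. -/
noncomputable def distOn {α D : Type*} [DecidableEq D] (A : Finset α) (F : α → D) (d : D) : ℝ :=
  ((A.filter fun x => F x = d).card : ℝ) / (A.card : ℝ)

/-- The correlation of an `m`-tuple (`m ≥ 1`) of distributions on a finite set `D`, each given by
its point masses: `(∑_d ℙ[X₁ = d] ⋯ ℙ[X_m = d]) - 1 / |D|^(m-1)`. -/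
noncomputable def correlation {D : Type*} [Fintype D] {m : ℕ} (X : Fin m → D → ℝ) : ℝ :=
  (∑ d : D, ∏ t : Fin m, X t d) - 1 / (Fintype.card D : ℝ) ^ (m - 1)

/-- The correlation of the distributions of the restriction to the cube of the mod-`p` form `φ` on
each of the subsets `A 0, …, A (m-1)` of the cube. -/
noncomputable def formCorrelation {p n m : ℕ} [NeZero p] (A : Fin m → Finset (Cube n))
    (φ : ModForm p n) : ℝ :=
  correlation fun t => distOn (A t) fun x => φ (x.toZMod p)

/-! Call a form biased on `A` if some value has probability below `1/p - η` there. On every other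
form the law is almost bounded below by the uniform law. Bias forces a large Fourier coefficient,
and characters of the cube whose coefficient vectors differ in many places are nearly orthogonal, so
a dense set has only polynomially many biased forms (`card_large_coeff_le`, `card_biasedForms_le`).

By Chernoff and a union bound, `k = O(log (n+1))` random points of `A` have empirical laws at most
`η` above the true ones, for all biased forms at once. At least a proportion `δ^k / 2` of all
`k`-tuples in the cube is thus good for each `A i`, so by averaging one tuple serves a fraction `δ^k
/ 2`, polynomial in `1/(n+1)`, of the indices (`exists_common_sample`). These form `R`.

For a form and sets indexed by `R`, every law is then bounded below, up to `η`, by the same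
empirical law `E` or by the uniform law. The power mean inequality bounds the correlation below
(`neg_le_correlation`). Every tuple in `R^m` works, not only a proportion `1 - ε`. -/

/-! ### Concentration of empirical frequencies -/

/-- A Chernoff bound for the empirical frequency of a property along a uniformly random sequence of
elements of a finite set. -/
theorem card_filter_frequency_le {α : Type*} [DecidableEq α] (A : Finset α) (hA : A.Nonempty)
    (P : α → Prop) [DecidablePred P] (k : ℕ) {η : ℝ} (hη0 : 0 < η) (hη1 : η ≤ 1) :
    (((Fintype.piFinset fun _ : Fin k => A).filter fun x =>
      (((A.filter P).card : ℝ) / A.card + η) * k < ((Finset.univ.filter fun j => P (x j)).card : ℝ)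
      ).card : ℝ) ≤ (A.card : ℝ) ^ k * Real.exp (-(k * η ^ 2 / 4)) := by
  have hA0 : (0 : ℝ) < A.card := by exact_mod_cast hA.card_pos
  set β : ℝ := ((A.filter P).card : ℝ) / A.card with hβ
  have hβ0 : 0 ≤ β := by positivity
  have hβ1 : β ≤ 1 := by
    rw [hβ, div_le_one hA0]; exact_mod_cast Finset.card_filter_le _ _
  -- This minimises the exponent `k (l² - l η)` left by the moment bound, with value `-k η² / 4`.
  set l : ℝ := η / 2 with hl
  have hl0 : 0 < l := by positivity
  let g : α → ℝ := fun a => if P a then Real.exp l else 1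
  have hg : ∀ a, 0 ≤ g a := fun a => by dsimp only [g]; split_ifs <;> positivity
  have hprod : ∀ x : Fin k → α,
      ∏ j, g (x j) = Real.exp (l * (Finset.univ.filter fun j => P (x j)).card) := by
    intro x
    simp only [g]
    rw [Finset.prod_ite, Finset.prod_const, Finset.prod_const_one, mul_one, ← Real.exp_nat_mul,
      mul_comm]
  have hmoment : ∑ x ∈ Fintype.piFinset (fun _ : Fin k => A), ∏ j, g (x j)
      = (∑ a ∈ A, g a) ^ k := by
    rw [← Finset.prod_univ_sum, Finset.prod_const, Finset.card_univ, Fintype.card_fin]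
  have hsum : ∑ a ∈ A, g a = A.card * (1 + β * (Real.exp l - 1)) := by
    have h1 : ∀ a, g a = 1 + (Real.exp l - 1) * (if P a then 1 else 0) := by
      intro a; dsimp only [g]; split_ifs <;> ring
    simp only [h1]
    rw [Finset.sum_add_distrib, ← Finset.mul_sum, Finset.sum_boole, hβ]
    simp only [Finset.sum_const, nsmul_eq_mul, mul_one]
    field_simp
  have hexp : Real.exp l - 1 ≤ l + l ^ 2 := by
    have := Real.abs_exp_sub_one_sub_id_le (x := l) (by rw [abs_of_pos hl0]; linarith)
    have := (abs_le.mp this).2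
    linarith
  have hbase : 1 + β * (Real.exp l - 1) ≤ Real.exp (β * l + l ^ 2) := by
    have h1 : β * (Real.exp l - 1) ≤ β * l + l ^ 2 := by
      have h2 := mul_le_mul_of_nonneg_left hexp hβ0
      have h3 := mul_le_mul_of_nonneg_right hβ1 (sq_nonneg l)
      linarith
    linarith [Real.add_one_le_exp (β * l + l ^ 2)]
  have hbase0 : 0 ≤ 1 + β * (Real.exp l - 1) := by
    have : 0 ≤ Real.exp l - 1 := by linarith [Real.add_one_le_exp l]
    positivity
  set S := (Fintype.piFinset fun _ : Fin k => A).filter fun x =>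
      (β + η) * k < ((Finset.univ.filter fun j => P (x j)).card : ℝ) with hS
  have hmarkov : (S.card : ℝ) * Real.exp (l * ((β + η) * k)) ≤ (∑ a ∈ A, g a) ^ k := by
    rw [← hmoment, ← nsmul_eq_mul, ← Finset.sum_const]
    refine le_trans (Finset.sum_le_sum fun x hx => ?_)
      (Finset.sum_le_sum_of_subset_of_nonneg (Finset.filter_subset _ _)
        fun x _ _ => Finset.prod_nonneg fun j _ => hg _)
    rw [hprod]
    exact Real.exp_le_exp.mpr (mul_le_mul_of_nonneg_left (Finset.mem_filter.mp hx).2.le hl0.le)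
  have hpow : (∑ a ∈ A, g a) ^ k ≤ (A.card : ℝ) ^ k * Real.exp (k * (β * l + l ^ 2)) := by
    rw [hsum, mul_pow, Real.exp_nat_mul]
    gcongr
  have h : (S.card : ℝ) * Real.exp (l * ((β + η) * k))
      ≤ ((A.card : ℝ) ^ k * Real.exp (-(k * η ^ 2 / 4))) * Real.exp (l * ((β + η) * k)) := by
    refine (hmarkov.trans hpow).trans (le_of_eq ?_)
    rw [mul_assoc, ← Real.exp_add]
    congr 2
    rw [hl]; ring
  exact le_of_mul_le_mul_right h (Real.exp_pos _)

/-! ### Lower bounds for correlations -/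

theorem prod_sub_card_mul_le_prod {ι : Type*} (s : Finset ι) (P Q : ι → ℝ) {η : ℝ}
    (hP0 : ∀ t, 0 ≤ P t) (hP1 : ∀ t, P t ≤ 1) (hQ0 : ∀ t, 0 ≤ Q t) (hQ1 : ∀ t, Q t ≤ 1)
    (h : ∀ t, Q t - η ≤ P t) (hη : 0 ≤ η) : ∏ t ∈ s, Q t - s.card * η ≤ ∏ t ∈ s, P t := by
  classical
  induction s using Finset.induction_on with
  | empty => simp
  | insert a s ha ih =>
    rw [Finset.prod_insert ha, Finset.prod_insert ha, Finset.card_insert_of_notMem ha]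
    have h1 : 0 ≤ ∏ t ∈ s, Q t := Finset.prod_nonneg fun t _ => hQ0 t
    have h2 : ∏ t ∈ s, Q t ≤ 1 := Finset.prod_le_one (fun t _ => hQ0 t) fun t _ => hQ1 t
    have h3 := mul_le_mul_of_nonneg_left ih (hP0 a)
    have h4 := mul_le_mul_of_nonneg_right (h a) h1
    have h5 : P a * (s.card * η) ≤ s.card * η := mul_le_of_le_one_left (by positivity) (hP1 a)
    have h6 : η * ∏ t ∈ s, Q t ≤ η := mul_le_of_le_one_right hη h2
    push_cast
    linarith

/-- A product of copies of one distribution and of the uniform distribution has total mass at least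
that of the product of uniform distributions. -/
theorem one_div_card_pow_le_sum_prod_ite {D : Type*} [Fintype D] [Nonempty D] {m : ℕ} (hm : 0 < m)
    (E : D → ℝ) (hE0 : ∀ d, 0 ≤ E d) (hE1 : ∑ d, E d = 1) (u : Fin m → Prop) [DecidablePred u] :
    1 / (Fintype.card D : ℝ) ^ (m - 1)
      ≤ ∑ d : D, ∏ t : Fin m, if u t then E d else 1 / (Fintype.card D : ℝ) := by
  have hD : (0 : ℝ) < Fintype.card D := by exact_mod_cast Fintype.card_pos
  set q : ℝ := (Fintype.card D : ℝ) with hq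
  have hcard : (Finset.univ.filter u).card + (Finset.univ.filter fun t => ¬ u t).card = m := by
    simpa using Finset.card_filter_add_card_filter_not (s := (Finset.univ : Finset (Fin m))) u
  set r := (Finset.univ.filter fun t => ¬ u t).card
  simp only [Finset.prod_ite, Finset.prod_const]
  rw [← Finset.sum_mul]
  rcases hv : (Finset.univ.filter u).card with _ | v
  · rw [hv, zero_add] at hcard
    obtain ⟨m', rfl⟩ : ∃ m', m = m' + 1 := ⟨m - 1, by omega⟩
    rw [show (Finset.univ.filter fun t => ¬ u t).card = m' + 1 from hcard]
    simp only [pow_zero, Finset.sum_const, Finset.card_univ, nsmul_eq_mul, mul_one, ← hq,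
      Nat.add_sub_cancel]
    rw [pow_succ]
    apply le_of_eq
    field_simp
    rw [← mul_pow, mul_one_div_cancel hD.ne', one_pow]
  -- With `v + 1` copies of `E`, the power mean inequality gives `∑ E^(v+1) ≥ 1 / q^v`; the `r`
  -- uniform factors supply the rest.
  · have hpm := pow_sum_div_card_le_sum_pow (s := Finset.univ) (f := E) (fun d _ => hE0 d) v
    rw [hE1, one_pow, Finset.card_univ, ← hq] at hpm
    have hmv : m - 1 = v + r := by omega
    rw [hmv, pow_add, ← one_div_mul_one_div, ← one_div_pow (n := r)]
    exact mul_le_mul_of_nonneg_right hpm (by positivity)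

theorem distOn_nonneg {α D : Type*} [DecidableEq D] (A : Finset α) (F : α → D) (d : D) :
    0 ≤ distOn A F d := by
  unfold distOn; positivity

theorem distOn_le_one {α D : Type*} [DecidableEq D] (A : Finset α) (F : α → D) (d : D) :
    distOn A F d ≤ 1 :=
  div_le_one_of_le₀ (by exact_mod_cast Finset.card_filter_le _ _) (by positivity)

theorem sum_distOn {α D : Type*} [DecidableEq D] [Fintype D] {A : Finset α} (hA : A.Nonempty)
    (F : α → D) : ∑ d, distOn A F d = 1 := by
  unfold distOn
  rw [← Finset.sum_div, div_eq_one_iff_eq (by exact_mod_cast hA.card_pos.ne')]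
  norm_cast
  exact (Finset.card_eq_sum_card_fiberwise fun _ _ => Finset.mem_coe.mpr (Finset.mem_univ _)).symm

/-- If each of `m` distributions is bounded below, up to `η`, either by a fixed distribution `E` or
by the uniform one, then their correlation is at least `-η m |D|`. -/
theorem neg_le_correlation {D : Type*} [Fintype D] [Nonempty D] {m : ℕ} (hm : 0 < m)
    (X : Fin m → D → ℝ) (hX0 : ∀ t d, 0 ≤ X t d) (hX1 : ∀ t d, X t d ≤ 1)
    (E : D → ℝ) (hE0 : ∀ d, 0 ≤ E d) (hE1 : ∑ d, E d = 1) {η : ℝ} (hη : 0 ≤ η)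
    (h : ∀ t, (∀ d, E d - η ≤ X t d) ∨ ∀ d, 1 / (Fintype.card D : ℝ) - η ≤ X t d) :
    -(Fintype.card D * (m * η)) ≤ correlation X := by
  classical
  let u : Fin m → Prop := fun t => ∀ d, E d - η ≤ X t d
  have hD : (1 : ℝ) ≤ Fintype.card D := by exact_mod_cast Fintype.card_pos (α := D)
  have hEle : ∀ d, E d ≤ 1 := fun d =>
    hE1 ▸ Finset.single_le_sum (fun d _ => hE0 d) (Finset.mem_univ d)
  have h1 := one_div_card_pow_le_sum_prod_ite hm E hE0 hE1 u
  have h2 : ∀ d : D, (∏ t : Fin m, if u t then E d else 1 / (Fintype.card D : ℝ)) - m * η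
      ≤ ∏ t, X t d := by
    intro d
    have := prod_sub_card_mul_le_prod Finset.univ (fun t => X t d)
      (fun t => if u t then E d else 1 / (Fintype.card D : ℝ)) (η := η) (fun t => hX0 t d)
      (fun t => hX1 t d)
      (fun t => by split_ifs <;> [exact hE0 d; positivity])
      (fun t => by split_ifs <;> [exact hEle d; exact div_le_one_of_le₀ hD (by positivity)])
      (fun t => by
        split_ifs with hu
        · exact hu d
        · exact (h t).resolve_left hu d) hη
    simpa using this
  have h3 := Finset.sum_le_sum fun d (_ : d ∈ Finset.univ) => h2 d
  rw [Finset.sum_sub_distrib, Finset.sum_const, Finset.card_univ, nsmul_eq_mul] at h3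
  unfold correlation
  linarith

/-! ### Fourier analysis on the cube -/

open ZMod in
/-- A deficient value of a random variable in `ZMod p` forces a large Fourier coefficient. -/
theorem exists_large_coeff_of_distOn_lt {p : ℕ} [Fact p.Prime] {α : Type*} {A : Finset α}
    (hA : A.Nonempty) (F : α → ZMod p) (y : ZMod p) {η : ℝ} (hη : 0 ≤ η)
    (h : distOn A F y < 1 / (p : ℝ) - η) :
    ∃ a : ZMod p, a ≠ 0 ∧ η * A.card ≤ ‖∑ x ∈ A, stdAddChar (a * F x)‖ := by
  by_contra! hcon
  have hA0 : (0 : ℝ) < A.card := by exact_mod_cast hA.card_pos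
  have hp : (0 : ℝ) < p := by exact_mod_cast (Fact.out : p.Prime).pos
  -- Fourier inversion at `y`; the term `a = 0` is `A.card`, so the other terms measure the
  -- deviation from uniformity.
  have key : ∑ a : ZMod p, stdAddChar (-(a * y)) * ∑ x ∈ A, stdAddChar (a * F x)
      = (p * (A.filter fun x => F x = y).card : ℂ) := by
    simp only [Finset.mul_sum, ← AddChar.map_add_eq_mul]
    rw [Finset.sum_comm]
    have : ∀ x ∈ A, ∑ a : ZMod p, stdAddChar (-(a * y) + a * F x)
        = if F x = y then (p : ℂ) else 0 := by
      intro x _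
      have := AddChar.sum_mulShift (F x - y) (isPrimitive_stdAddChar p)
      simp only [sub_eq_zero, ZMod.card] at this
      rw [Nat.cast_ite, Nat.cast_zero] at this
      rw [← this]
      refine Finset.sum_congr rfl fun a _ => ?_
      congr 1; ring
    rw [Finset.sum_congr rfl this, ← Finset.sum_filter, Finset.sum_const, nsmul_eq_mul, mul_comm]
  rw [← Finset.add_sum_erase _ _ (Finset.mem_univ (0 : ZMod p))] at key
  simp only [zero_mul, neg_zero, AddChar.map_zero_eq_one, Finset.sum_const, nsmul_eq_mul,
    mul_one, one_mul] at key
  have hnorm : ‖(p * (A.filter fun x => F x = y).card - A.card : ℂ)‖ ≤ p * (η * A.card) := by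
    rw [← key, add_sub_cancel_left]
    refine (norm_sum_le _ _).trans ?_
    have : ∀ a ∈ Finset.univ.erase (0 : ZMod p),
        ‖stdAddChar (-(a * y)) * ∑ x ∈ A, stdAddChar (a * F x)‖ ≤ η * A.card := by
      intro a ha
      rw [norm_mul, AddChar.norm_apply, one_mul]
      exact (hcon a (Finset.ne_of_mem_erase ha)).le
    refine (Finset.sum_le_card_nsmul _ _ _ this).trans ?_
    rw [nsmul_eq_mul]
    gcongr
    exact (Finset.card_le_univ _).trans (ZMod.card p).le
  have hreal : |(p * (A.filter fun x => F x = y).card - A.card : ℝ)| ≤ p * (η * A.card) := by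
    rw [← Real.norm_eq_abs, ← Complex.norm_real]; push_cast; exact hnorm
  have h1 := (abs_le.mp hreal).1
  unfold distOn at h
  rw [div_lt_iff₀ hA0] at h
  have h2 := mul_lt_mul_of_pos_left h hp
  have h3 : (p : ℝ) * ((1 / (p : ℝ) - η) * A.card) = A.card - p * (η * A.card) := by
    field_simp
  linarith

-- Equality in the triangle inequality would force the root of unity to be `1`, and there are only
-- finitely many `a`.
open ZMod in
theorem exists_norm_one_add_stdAddChar_le (p : ℕ) [Fact p.Prime] :
    ∃ θ : ℝ, 0 < θ ∧ θ < 1 ∧ ∀ a : ZMod p, a ≠ 0 → ‖1 + stdAddChar a‖ ≤ 2 * θ := by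
  classical
  have hlt : ∀ a : ZMod p, a ≠ 0 → ‖1 + stdAddChar a‖ / 2 < 1 := by
    intro a ha
    have h0 : stdAddChar a ≠ (1 : ℂ) := by
      rw [← AddChar.map_zero_eq_one (stdAddChar (N := p))]
      exact fun h => ha (injective_stdAddChar h)
    have h1 : ‖(stdAddChar a : ℂ)‖ = 1 := AddChar.norm_apply _ _
    have : ‖1 + stdAddChar a‖ < 2 := by
      have h2 : ‖(1 : ℂ) + stdAddChar a‖ ≠ ‖(1 : ℂ)‖ + ‖(stdAddChar a : ℂ)‖ := by
        intro h
        have := (sameRay_iff_norm_add.mpr h)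
        have := (sameRay_iff_of_norm_eq (by rw [h1, norm_one])).mp this
        exact h0 this.symm
      have h3 := lt_of_le_of_ne (norm_add_le _ _) h2
      rw [h1, norm_one] at h3
      linarith
    linarith
  have : ∃ θ : ℝ, 0 < θ ∧ θ < 1 ∧ ∀ a ∈ (Finset.univ.erase (0 : ZMod p)),
      ‖1 + stdAddChar a‖ / 2 ≤ θ := by
    -- The extra `1 / 2` keeps `θ` positive when `p = 2`, where the only other value is `0`.
    let S := insert (1 / 2 : ℝ)
      ((Finset.univ.erase (0 : ZMod p)).image fun a => ‖1 + stdAddChar a‖ / 2)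
    have hS : S.Nonempty := Finset.insert_nonempty _ _
    refine ⟨S.max' hS, ?_, ?_, fun a ha => Finset.le_max' _ _ ?_⟩
    · exact lt_of_lt_of_le (by norm_num) (Finset.le_max' S (1 / 2) (Finset.mem_insert_self _ _))
    · rw [Finset.max'_lt_iff]
      intro z hz
      rcases Finset.mem_insert.mp hz with rfl | hz
      · norm_num
      · obtain ⟨a, ha, rfl⟩ := Finset.mem_image.mp hz
        exact hlt a (Finset.ne_of_mem_erase ha)
    · exact Finset.mem_insert_of_mem (Finset.mem_image_of_mem _ ha)
  obtain ⟨θ, h0, h1, h⟩ := this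
  exact ⟨θ, h0, h1, fun a ha => by
    linarith [h a (Finset.mem_erase.mpr ⟨ha, Finset.mem_univ _⟩)]⟩

theorem AddChar.map_finsetSum_eq_prod {ι G R : Type*} [AddCommMonoid G] [CommMonoid R] (ψ : AddChar G R)
    (s : Finset ι) (f : ι → G) : ψ (∑ i ∈ s, f i) = ∏ i ∈ s, ψ (f i) := by
  classical
  induction s using Finset.induction_on with
  | empty => simp
  | insert a s ha ih => rw [Finset.sum_insert ha, Finset.prod_insert ha, map_add_eq_mul, ih]

-- The sum factorises over coordinates, and each nonzero coefficient contributes a saving `θ`.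
open ZMod in
theorem norm_sum_cube_stdAddChar_le {p n : ℕ} [Fact p.Prime] {θ : ℝ}
    (hθ : ∀ a : ZMod p, a ≠ 0 → ‖1 + stdAddChar a‖ ≤ 2 * θ) (c : Fin n → ZMod p) :
    ‖∑ x : Cube n, stdAddChar (∑ i, c i * x.toZMod p i)‖
      ≤ 2 ^ n * θ ^ (Finset.univ.filter fun i => c i ≠ 0).card := by
  have h1 : ∑ x : Cube n, stdAddChar (∑ i, c i * x.toZMod p i) = ∏ i, (1 + stdAddChar (c i)) := by
    have h2 : ∀ x : Cube n, stdAddChar (∑ i, c i * x.toZMod p i)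
        = ∏ i, stdAddChar (c i * (((x i : ℕ) : ZMod p))) := fun x =>
      AddChar.map_finsetSum_eq_prod _ _ _
    simp only [h2]
    have := Finset.prod_univ_sum (fun _ : Fin n => (Finset.univ : Finset (Fin 2)))
      (fun i b => (stdAddChar (c i * ((b : ℕ) : ZMod p)) : ℂ))
    rw [Fintype.piFinset_univ] at this
    rw [← this]
    refine Finset.prod_congr rfl fun i _ => ?_
    simp [Fin.sum_univ_two]
  rw [h1, norm_prod]
  calc ∏ i, ‖1 + stdAddChar (c i)‖ ≤ ∏ i, 2 * (if c i ≠ 0 then θ else 1) := by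
        refine Finset.prod_le_prod (fun _ _ => norm_nonneg _) fun i _ => ?_
        split_ifs with h
        · exact hθ _ h
        · rw [not_not.mp h, AddChar.map_zero_eq_one]; norm_num
    _ = _ := by
        rw [Finset.prod_mul_distrib, Finset.prod_const, Finset.card_univ, Fintype.card_fin,
          Finset.prod_ite, Finset.prod_const, Finset.prod_const_one, mul_one]

/-- A polynomial bound for the size of a Hamming ball. -/
theorem card_filter_support_le_le (p n L : ℕ) [NeZero p] :
    ((Finset.univ.filter fun c : Fin n → ZMod p =>
      (Finset.univ.filter fun i => c i ≠ 0).card ≤ L).card : ℝ)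
      ≤ Real.exp p * ((n : ℝ) + 1) ^ L := by
  -- Weighting each vector by `z ^ |support|` gives total mass at most `exp p`, while each vector in
  -- the ball weighs at least `z ^ L`.
  set z : ℝ := 1 / ((n : ℝ) + 1) with hz
  have hz0 : 0 < z := by positivity
  have hz1 : z ≤ 1 := by rw [hz, div_le_one (by positivity)]; linarith [(n.cast_nonneg : (0:ℝ) ≤ n)]
  have htotal : ∑ c : Fin n → ZMod p, z ^ (Finset.univ.filter fun i => c i ≠ 0).card
      = (1 + ((p : ℝ) - 1) * z) ^ n := by
    have h1 : ∀ c : Fin n → ZMod p, z ^ (Finset.univ.filter fun i => c i ≠ 0).card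
        = ∏ i, if c i ≠ 0 then z else 1 := fun c => by
      rw [Finset.prod_ite, Finset.prod_const, Finset.prod_const_one, mul_one]
    have := Finset.prod_univ_sum (fun _ : Fin n => (Finset.univ : Finset (ZMod p)))
      (fun _ b => if b ≠ 0 then z else 1)
    rw [Fintype.piFinset_univ] at this
    simp only [h1]
    rw [← this, Finset.prod_const, Finset.card_univ, Fintype.card_fin,
      ← Finset.add_sum_erase _ _ (Finset.mem_univ (0 : ZMod p)),
      Finset.sum_congr rfl fun b hb => if_pos (Finset.ne_of_mem_erase hb)]
    rw [Finset.sum_const, Finset.card_erase_of_mem (Finset.mem_univ _), Finset.card_univ, ZMod.card,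
      nsmul_eq_mul, Nat.cast_pred (Nat.pos_of_neZero p)]
    simp
  have hbound : (1 + ((p : ℝ) - 1) * z) ^ n ≤ Real.exp p := by
    have hp : (1 : ℝ) ≤ p := by exact_mod_cast Nat.pos_of_neZero p
    calc (1 + ((p : ℝ) - 1) * z) ^ n ≤ Real.exp (((p : ℝ) - 1) * z) ^ n := by
          have : 0 ≤ ((p : ℝ) - 1) * z := mul_nonneg (by linarith) hz0.le
          gcongr
          linarith [Real.add_one_le_exp (((p : ℝ) - 1) * z)]
      _ = Real.exp (n * (((p : ℝ) - 1) * z)) := (Real.exp_nat_mul _ _).symm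
      _ ≤ Real.exp p := by
          apply Real.exp_le_exp.mpr
          have h1 : n * z ≤ 1 := by
            rw [hz, mul_one_div, div_le_one (by positivity)]; linarith
          have := mul_le_mul_of_nonneg_left h1 (by linarith : (0 : ℝ) ≤ (p : ℝ) - 1)
          linarith
  set S := Finset.univ.filter fun c : Fin n → ZMod p =>
      (Finset.univ.filter fun i => c i ≠ 0).card ≤ L
  have hS : S.card * z ^ L ≤ Real.exp p := by
    refine le_trans ?_ (htotal ▸ hbound)
    rw [← nsmul_eq_mul, ← Finset.sum_const]
    refine le_trans (Finset.sum_le_sum fun c hc => ?_)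
      (Finset.sum_le_sum_of_subset_of_nonneg (Finset.filter_subset _ _) fun _ _ _ => by positivity)
    exact pow_le_pow_of_le_one hz0.le hz1 (Finset.mem_filter.mp hc).2
  rw [hz, one_div_pow, mul_one_div, div_le_iff₀ (by positivity)] at hS
  exact hS

open ZMod in
/-- A dense subset of the cube has only polynomially many large Fourier coefficients. -/
theorem card_large_coeff_le {p n : ℕ} [Fact p.Prime] {θ : ℝ} (hθ0 : 0 < θ) (hθ1 : θ < 1)
    (hθ : ∀ a : ZMod p, a ≠ 0 → ‖1 + stdAddChar a‖ ≤ 2 * θ) {A : Finset (Cube n)} {δ η : ℝ}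
    (hδ : 0 < δ) (hη : 0 < η) (hA : δ * 2 ^ n ≤ (A.card : ℝ)) {L : ℕ} (hL : θ ^ L ≤ δ * η ^ 2 / 2)
    (H : Finset (Fin n → ZMod p))
    (hH : ∀ c ∈ H, η * A.card ≤ ‖∑ x ∈ A, stdAddChar (∑ i, c i * x.toZMod p i)‖) :
    (H.card : ℝ) ≤ 2 / (δ * η ^ 2) * (Real.exp p * ((n : ℝ) + 1) ^ L) := by
  classical
  have hA0 : (0 : ℝ) < A.card := lt_of_lt_of_le (by positivity) hA
  let e : (Fin n → ZMod p) → Cube n → ℂ := fun c x => stdAddChar (∑ i, c i * x.toZMod p i)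
  -- The phases `u c` align the large coefficients, so `T` has large `L¹` norm on `A`;
  -- near-orthogonality bounds its `L²` norm, and Cauchy–Schwarz compares the two.
  choose u hu1 hu using fun c => Complex.exists_norm_eq_mul_self (∑ x ∈ A, e c x)
  let T : Cube n → ℂ := fun x => ∑ c ∈ H, u c * e c x
  set B : ℝ := Real.exp p * ((n : ℝ) + 1) ^ L
  have hlow : (H.card : ℝ) * (η * A.card) ≤ ∑ x ∈ A, ‖T x‖ := by
    have h1 : ((∑ c ∈ H, ‖∑ x ∈ A, e c x‖ : ℝ) : ℂ) = ∑ x ∈ A, T x := by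
      push_cast
      simp only [hu, T, Finset.mul_sum]
      exact Finset.sum_comm
    calc (H.card : ℝ) * (η * A.card) ≤ ∑ c ∈ H, ‖∑ x ∈ A, e c x‖ := by
          rw [← nsmul_eq_mul, ← Finset.sum_const]; exact Finset.sum_le_sum hH
      _ = ‖((∑ c ∈ H, ‖∑ x ∈ A, e c x‖ : ℝ) : ℂ)‖ := by
          rw [Complex.norm_real, Real.norm_of_nonneg (Finset.sum_nonneg fun _ _ => norm_nonneg _)]
      _ ≤ _ := by rw [h1]; exact norm_sum_le _ _
  -- Vectors within distance `L` of `d` are counted by a Hamming ball; the others contribute at most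
  -- `θ ^ L` each.
  have hrow : ∀ d ∈ H, ∑ c ∈ H, θ ^ (Finset.univ.filter fun i => (c - d) i ≠ 0).card
      ≤ B + H.card * θ ^ L := by
    intro d _
    rw [← Finset.sum_filter_add_sum_filter_not H
      (fun c => (Finset.univ.filter fun i => (c - d) i ≠ 0).card ≤ L)]
    refine add_le_add ?_ ?_
    · refine (Finset.sum_le_card_nsmul _ _ 1 fun c _ => pow_le_one₀ hθ0.le hθ1.le).trans ?_
      rw [nsmul_eq_mul, mul_one]
      refine le_trans ?_ (card_filter_support_le_le p n L)
      exact_mod_cast Finset.card_le_card_of_injOn (fun c => c - d)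
        (fun c hc => by simpa using (Finset.mem_filter.mp hc).2)
        (fun _ _ _ _ h => sub_left_injective h)
    · refine (Finset.sum_le_card_nsmul _ _ (θ ^ L) fun c hc => ?_).trans ?_
      · exact pow_le_pow_of_le_one hθ0.le hθ1.le (not_le.mp (Finset.mem_filter.mp hc).2).le
      · rw [nsmul_eq_mul]
        gcongr
        exact Finset.filter_subset _ _
  have hsq : ∑ x, ‖T x‖ ^ 2 ≤ 2 ^ n * (H.card * (B + H.card * θ ^ L)) := by
    have h1 : ((∑ x, ‖T x‖ ^ 2 : ℝ) : ℂ)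
        = ∑ d ∈ H, ∑ c ∈ H, (u c * (starRingEnd ℂ) (u d)) * ∑ x, e (c - d) x := by
      have h2 : ∀ x, ((‖T x‖ ^ 2 : ℝ) : ℂ)
          = ∑ d ∈ H, ∑ c ∈ H, (u c * (starRingEnd ℂ) (u d)) * e (c - d) x := by
        intro x
        push_cast
        rw [← Complex.mul_conj']
        simp only [T, map_sum, map_mul]
        rw [Finset.sum_mul_sum, Finset.sum_comm]
        refine Finset.sum_congr rfl fun d _ => Finset.sum_congr rfl fun c _ => ?_
        have h3 : e (c - d) x = e c x * (starRingEnd ℂ) (e d x) := by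
          simp only [e]
          rw [← AddChar.map_neg_eq_conj, ← AddChar.map_add_eq_mul]
          congr 1
          simp only [Pi.sub_apply, sub_mul, Finset.sum_sub_distrib]
          rw [sub_eq_add_neg]
        rw [h3]; ring
      push_cast at h2 ⊢
      simp only [h2, Finset.mul_sum]
      rw [Finset.sum_comm]
      exact Finset.sum_congr rfl fun d _ => Finset.sum_comm
    have h4 : ∑ x, ‖T x‖ ^ 2 = ‖((∑ x, ‖T x‖ ^ 2 : ℝ) : ℂ)‖ := by
      rw [Complex.norm_real, Real.norm_of_nonneg (Finset.sum_nonneg fun _ _ => by positivity)]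
    rw [h4, h1]
    calc _ ≤ ∑ d ∈ H, ∑ c ∈ H,
          2 ^ n * θ ^ (Finset.univ.filter fun i => (c - d) i ≠ 0).card := by
          refine (norm_sum_le _ _).trans (Finset.sum_le_sum fun d _ => ?_)
          refine (norm_sum_le _ _).trans (Finset.sum_le_sum fun c _ => ?_)
          rw [norm_mul, norm_mul, RCLike.norm_conj, hu1, hu1, one_mul, one_mul]
          exact norm_sum_cube_stdAddChar_le hθ _
      _ ≤ ∑ d ∈ H, 2 ^ n * (B + H.card * θ ^ L) := by
          refine Finset.sum_le_sum fun d hd => ?_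
          rw [← Finset.mul_sum]
          exact mul_le_mul_of_nonneg_left (hrow d hd) (by positivity)
      _ = _ := by rw [Finset.sum_const, nsmul_eq_mul]; ring
  have hcs : (∑ x ∈ A, ‖T x‖) ^ 2 ≤ A.card * ∑ x, ‖T x‖ ^ 2 := by
    refine sq_sum_le_card_mul_sum_sq.trans ?_
    gcongr
    exact Finset.subset_univ _
  rcases H.eq_empty_or_nonempty with rfl | hne
  · simp only [Finset.card_empty, Nat.cast_zero]; positivity
  have hN : (0 : ℝ) < H.card := by exact_mod_cast hne.card_pos
  set N : ℝ := (H.card : ℝ)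
  have h1 : (N * (η * A.card)) ^ 2 ≤ A.card * (2 ^ n * (N * (B + N * θ ^ L))) :=
    (pow_le_pow_left₀ (by positivity) hlow 2).trans (hcs.trans (by gcongr))
  have h2 : N * η ^ 2 * A.card ≤ 2 ^ n * (B + N * θ ^ L) := by
    refine le_of_mul_le_mul_left ?_ (mul_pos hN hA0)
    linarith
  have h3 : N * η ^ 2 * δ ≤ B + N * θ ^ L := by
    refine le_of_mul_le_mul_left ?_ (by positivity : (0 : ℝ) < 2 ^ n)
    have := mul_le_mul_of_nonneg_left hA (by positivity : 0 ≤ N * η ^ 2)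
    linarith
  -- The choice of `L` lets the far pairs be absorbed into half of the left side of `h3`.
  have h4 := mul_le_mul_of_nonneg_left hL hN.le
  rw [div_mul_eq_mul_div, le_div_iff₀ (by positivity)]
  linarith

/-! ### Biased forms and common samples -/

/-- The forms, given by their coefficients, that take some value on `A` with a probability smaller
than `1 / p - η`. -/
noncomputable def biasedForms (p : ℕ) [NeZero p] {n : ℕ} (A : Finset (Cube n)) (η : ℝ) :
    Finset (Fin n → ZMod p) :=
  Finset.univ.filter fun c =>
    ∃ y, distOn A (fun x => ∑ i, c i * x.toZMod p i) y < 1 / (p : ℝ) - η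

open ZMod in
theorem card_biasedForms_le {p n : ℕ} [Fact p.Prime] {θ : ℝ} (hθ0 : 0 < θ) (hθ1 : θ < 1)
    (hθ : ∀ a : ZMod p, a ≠ 0 → ‖1 + stdAddChar a‖ ≤ 2 * θ) {A : Finset (Cube n)} {δ η : ℝ}
    (hδ : 0 < δ) (hη : 0 < η) (hA : δ * 2 ^ n ≤ (A.card : ℝ)) {L : ℕ}
    (hL : θ ^ L ≤ δ * η ^ 2 / 2) :
    ((biasedForms p A η).card : ℝ)
      ≤ p * (2 / (δ * η ^ 2) * (Real.exp p * ((n : ℝ) + 1) ^ L)) := by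
  classical
  have hA0 : (0 : ℝ) < A.card := lt_of_lt_of_le (by positivity) hA
  have hAne : A.Nonempty := Finset.card_pos.mp (by exact_mod_cast hA0)
  let G : ZMod p → Finset (Fin n → ZMod p) := fun a => Finset.univ.filter fun c =>
    a ≠ 0 ∧ η * A.card ≤ ‖∑ x ∈ A, stdAddChar (a * ∑ i, c i * x.toZMod p i)‖
  have hsub : biasedForms p A η ⊆ Finset.univ.biUnion G := by
    intro c hc
    obtain ⟨y, hy⟩ := (Finset.mem_filter.mp hc).2
    obtain ⟨a, ha, h⟩ := exists_large_coeff_of_distOn_lt hAne _ y hη.le hy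
    exact Finset.mem_biUnion.mpr
      ⟨a, Finset.mem_univ _, Finset.mem_filter.mpr ⟨Finset.mem_univ _, ha, h⟩⟩
  have hG : ∀ a, ((G a).card : ℝ) ≤ 2 / (δ * η ^ 2) * (Real.exp p * ((n : ℝ) + 1) ^ L) := by
    intro a
    by_cases ha : a = 0
    · have : G a = ∅ := by simp [G, ha]
      rw [this, Finset.card_empty, Nat.cast_zero]
      positivity
    -- Scaling by `a` turns these forms into coefficient vectors of large Fourier coefficients.
    · have hinj : Function.Injective fun c : Fin n → ZMod p => a • c := smul_right_injective _ ha
      rw [← Finset.card_image_of_injective _ hinj]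
      refine card_large_coeff_le hθ0 hθ1 hθ hδ hη hA hL _ fun b hb => ?_
      obtain ⟨c, hc, rfl⟩ := Finset.mem_image.mp hb
      have := (Finset.mem_filter.mp hc).2.2
      simpa only [Pi.smul_apply, smul_eq_mul, Finset.mul_sum, mul_assoc] using this
  calc ((biasedForms p A η).card : ℝ) ≤ ((Finset.univ.biUnion G).card : ℝ) := by
        exact_mod_cast Finset.card_le_card hsub
    _ ≤ ∑ a, ((G a).card : ℝ) := by exact_mod_cast Finset.card_biUnion_le
    _ ≤ _ := by
        refine (Finset.sum_le_card_nsmul _ _ _ fun a _ => hG a).trans ?_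
        rw [nsmul_eq_mul, Finset.card_univ, ZMod.card]

/-- For most sequences of elements of `A`, the empirical laws of all biased forms are bounded above,
up to `η`, by their laws on `A`. -/
theorem half_card_pow_le_card_good {p n : ℕ} [Fact p.Prime] {A : Finset (Cube n)}
    (hA : A.Nonempty) {η : ℝ} (hη0 : 0 < η) (hη1 : η ≤ 1) {k : ℕ} (hk : 0 < k)
    (hbad : (biasedForms p A η).card * p * Real.exp (-(k * η ^ 2 / 4)) ≤ 1 / 2) :
    (A.card : ℝ) ^ k / 2 ≤ (((Fintype.piFinset fun _ : Fin k => A).filter fun x =>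
      ∀ c ∈ biasedForms p A η, ∀ y,
        distOn Finset.univ (fun j => ∑ i, c i * (x j).toZMod p i) y - η
          ≤ distOn A (fun x => ∑ i, c i * x.toZMod p i) y).card : ℝ) := by
  classical
  set Good : (Fin k → Cube n) → Prop := fun x => ∀ c ∈ biasedForms p A η, ∀ y,
        distOn Finset.univ (fun j => ∑ i, c i * (x j).toZMod p i) y - η
          ≤ distOn A (fun x => ∑ i, c i * x.toZMod p i) y with hGood
  let Bad : (Fin n → ZMod p) × ZMod p → Finset (Fin k → Cube n) := fun cy =>
    (Fintype.piFinset fun _ : Fin k => A).filter fun x =>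
      (((A.filter fun x => ∑ i, cy.1 i * x.toZMod p i = cy.2).card : ℝ) / A.card + η) * k
        < ((Finset.univ.filter fun j => ∑ i, cy.1 i * (x j).toZMod p i = cy.2).card : ℝ)
  have hk0 : (0 : ℝ) < k := by exact_mod_cast hk
  have hsub : (Fintype.piFinset fun _ : Fin k => A).filter (fun x => ¬ Good x)
      ⊆ (biasedForms p A η ×ˢ Finset.univ).biUnion Bad := by
    intro x hx
    obtain ⟨hxA, hx⟩ := Finset.mem_filter.mp hx
    simp only [hGood] at hx
    push Not at hx
    obtain ⟨c, hc, y, hy⟩ := hx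
    refine Finset.mem_biUnion.mpr ⟨(c, y), by simpa using hc, Finset.mem_filter.mpr ⟨hxA, ?_⟩⟩
    rw [lt_sub_iff_add_lt] at hy
    unfold distOn at hy
    rw [Finset.card_univ, Fintype.card_fin, lt_div_iff₀ hk0] at hy
    exact hy
  have hle : (((Fintype.piFinset fun _ : Fin k => A).filter fun x => ¬ Good x).card : ℝ)
      ≤ (A.card : ℝ) ^ k / 2 := by
    calc _ ≤ ((((biasedForms p A η ×ˢ Finset.univ).biUnion Bad).card : ℕ) : ℝ) := by
          exact_mod_cast Finset.card_le_card hsub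
      _ ≤ ∑ cy ∈ biasedForms p A η ×ˢ Finset.univ, ((Bad cy).card : ℝ) := by
          exact_mod_cast Finset.card_biUnion_le
      _ ≤ (biasedForms p A η ×ˢ (Finset.univ : Finset (ZMod p))).card •
            ((A.card : ℝ) ^ k * Real.exp (-(k * η ^ 2 / 4))) :=
          Finset.sum_le_card_nsmul _ _ _ fun cy _ =>
            card_filter_frequency_le A hA (fun x => ∑ i, cy.1 i * x.toZMod p i = cy.2) k hη0 hη1
      _ = (A.card : ℝ) ^ k *
            ((biasedForms p A η).card * p * Real.exp (-(k * η ^ 2 / 4))) := by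
          rw [nsmul_eq_mul, Finset.card_product, Finset.card_univ, ZMod.card]
          push_cast
          ring
      _ ≤ (A.card : ℝ) ^ k * (1 / 2) := mul_le_mul_of_nonneg_left hbad (by positivity)
      _ = _ := by ring
  have htot := Finset.card_filter_add_card_filter_not
    (s := Fintype.piFinset fun _ : Fin k => A) Good
  rw [Fintype.card_piFinset_const] at htot
  have htot' : (((Fintype.piFinset fun _ : Fin k => A).filter Good).card : ℝ)
      + (((Fintype.piFinset fun _ : Fin k => A).filter fun x => ¬ Good x).card : ℝ)
      = (A.card : ℝ) ^ k := by exact_mod_cast htot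
  have : (A.card : ℝ) ^ k / 2 ≤ (((Fintype.piFinset fun _ : Fin k => A).filter Good).card : ℝ) := by
    linarith
  convert this

/-- Many of the sets share one sequence of points that represents all their biased forms. -/
theorem exists_common_sample {p n s : ℕ} [Fact p.Prime] (A : Fin s → Finset (Cube n)) {δ η : ℝ}
    (hδ : 0 < δ) (hA : ∀ i, δ * 2 ^ n ≤ ((A i).card : ℝ)) (hη0 : 0 < η) (hη1 : η ≤ 1) {k : ℕ}
    (hk : 0 < k)
    (hbad : ∀ i, (biasedForms p (A i) η).card * p * Real.exp (-(k * η ^ 2 / 4)) ≤ 1 / 2) :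
    ∃ (x : Fin k → Cube n) (R : Finset (Fin s)), s * (δ ^ k / 2) ≤ (R.card : ℝ) ∧
      ∀ i ∈ R, ∀ c ∈ biasedForms p (A i) η, ∀ y,
        distOn Finset.univ (fun j => ∑ z, c z * (x j).toZMod p z) y - η
          ≤ distOn (A i) (fun x => ∑ z, c z * x.toZMod p z) y := by
  classical
  have hne : ∀ i, (A i).Nonempty := fun i => by
    have : (0 : ℝ) < (A i).card := lt_of_lt_of_le (by positivity) (hA i)
    exact Finset.card_pos.mp (by exact_mod_cast this)
  let Q : Fin s → (Fin k → Cube n) → Prop := fun i x => x ∈ (Fintype.piFinset fun _ : Fin k => A i) ∧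
    ∀ c ∈ biasedForms p (A i) η, ∀ y,
        distOn Finset.univ (fun j => ∑ z, c z * (x j).toZMod p z) y - η
          ≤ distOn (A i) (fun x => ∑ z, c z * x.toZMod p z) y
  let R : (Fin k → Cube n) → Finset (Fin s) := fun x => Finset.univ.filter fun i => Q i x
  have hQ : ∀ i, (2 ^ n) ^ k * (δ ^ k / 2) ≤ ((Finset.univ.filter fun x => Q i x).card : ℝ) := by
    intro i
    have h1 := half_card_pow_le_card_good (hne i) hη0 hη1 hk (hbad i)
    have h2 := pow_le_pow_left₀ (by positivity) (hA i) k
    rw [mul_pow] at h2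
    refine le_trans (by linarith) (h1.trans (le_of_eq ?_))
    congr 2
    ext x
    simp only [Finset.mem_filter, Finset.mem_univ, true_and, Q]
  -- Double counting of the good pairs (sample, index).
  have hcount : ∑ x, ((R x).card : ℝ) = ∑ i, ((Finset.univ.filter fun x => Q i x).card : ℝ) := by
    exact_mod_cast Finset.sum_card_bipartiteAbove_eq_sum_card_bipartiteBelow (fun x i => Q i x)
  have hcard : ((Finset.univ : Finset (Fin k → Cube n)).card : ℝ) = (2 ^ n) ^ k := by
    simp
  obtain ⟨x, -, hx⟩ := Finset.exists_le_of_sum_le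
    (s := (Finset.univ : Finset (Fin k → Cube n))) (f := fun _ => (s : ℝ) * (δ ^ k / 2))
    (g := fun x => ((R x).card : ℝ)) Finset.univ_nonempty (by
      rw [Finset.sum_const, nsmul_eq_mul, hcard, hcount]
      have := Finset.card_nsmul_le_sum (Finset.univ : Finset (Fin s)) _ _ fun i _ => hQ i
      rw [Finset.card_univ, Fintype.card_fin, nsmul_eq_mul] at this
      linarith)
  exact ⟨x, R x, hx, fun i hi => ((Finset.mem_filter.mp hi).2).2⟩

/-! ### Choice of parameters and conclusion -/

theorem exists_sample_size (δ η K : ℝ) (hδ0 : 0 < δ) (hδ1 : δ ≤ 1) (hη : 0 < η) (L : ℕ) :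
    ∃ C : ℝ, 0 < C ∧ ∀ n : ℕ, 0 < n → ∃ k : ℕ, 0 < k ∧
      K * ((n : ℝ) + 1) ^ L * Real.exp (-(k * η ^ 2 / 4)) ≤ 1 ∧
      1 / ((n : ℝ) + 1) ^ C ≤ δ ^ k / 2 := by
  obtain ⟨M, hM⟩ := pow_unbounded_of_one_lt K (one_lt_two)
  set D : ℝ := 4 * (L + M : ℝ) / η ^ 2 with hD
  have hD0 : 0 ≤ D := by positivity
  have hlog : 0 ≤ -Real.log δ := by linarith [Real.log_nonpos hδ0.le hδ1]
  -- As `l ≥ 1/2`, the `4` absorbs the rounding in `⌈D * l⌉₊ + 1`; the final `+ 1` pays for the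
  -- factor `1/2`, as `n + 1 ≥ 2`.
  refine ⟨(D + 4) * -Real.log δ + 1, by positivity, fun n hn => ?_⟩
  have hn1 : (2 : ℝ) ≤ (n : ℝ) + 1 := by
    have : (1 : ℝ) ≤ n := by exact_mod_cast hn
    linarith
  have hn0 : (0 : ℝ) < (n : ℝ) + 1 := by linarith
  set l : ℝ := Real.log ((n : ℝ) + 1) with hl
  have hexp : Real.exp l = (n : ℝ) + 1 := Real.exp_log hn0
  have hl2 : 1 / 2 ≤ l := by
    have := Real.log_le_log (by norm_num) hn1
    linarith [Real.log_two_gt_d9]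
  refine ⟨⌈D * l⌉₊ + 1, Nat.succ_pos _, ?_, ?_⟩
  · have hk : D * l ≤ ((⌈D * l⌉₊ + 1 : ℕ) : ℝ) := by
      push_cast; linarith [Nat.le_ceil (D * l)]
    set k := ⌈D * l⌉₊ + 1
    have h1 : ((L + M : ℕ) : ℝ) * l ≤ k * η ^ 2 / 4 := by
      have h2 : ((L + M : ℕ) : ℝ) * l = (D * l) * η ^ 2 / 4 := by
        rw [hD]; push_cast; field_simp
      rw [h2]
      gcongr
    have h3 : K * ((n : ℝ) + 1) ^ L ≤ Real.exp (k * η ^ 2 / 4) := by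
      calc K * ((n : ℝ) + 1) ^ L ≤ ((n : ℝ) + 1) ^ M * ((n : ℝ) + 1) ^ L := by
            gcongr
            exact hM.le.trans (pow_le_pow_left₀ (by norm_num) hn1 M)
        _ = Real.exp (((L + M : ℕ) : ℝ) * l) := by
            rw [Real.exp_nat_mul, hexp, ← pow_add, add_comm M L]
        _ ≤ _ := Real.exp_le_exp.mpr h1
    rw [Real.exp_neg, ← div_eq_mul_inv, div_le_one (Real.exp_pos _)]
    exact h3
  · have hk : ((⌈D * l⌉₊ + 1 : ℕ) : ℝ) ≤ (D + 4) * l := by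
      push_cast
      have := Nat.ceil_lt_add_one (a := D * l) (by positivity)
      linarith
    set k := ⌈D * l⌉₊ + 1
    have h1 : δ ^ k = Real.exp (-(k * -Real.log δ)) := by
      rw [mul_neg, neg_neg, Real.exp_nat_mul, Real.exp_log hδ0]
    have h2 : Real.exp (-l) ≤ 1 / 2 := by
      rw [Real.exp_neg, hexp, inv_eq_one_div]
      exact one_div_le_one_div_of_le (by norm_num) hn1
    rw [Real.rpow_def_of_pos hn0, ← hl, one_div, ← Real.exp_neg, h1]
    calc Real.exp (-(l * ((D + 4) * -Real.log δ + 1)))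
        = Real.exp (-((D + 4) * l * -Real.log δ)) * Real.exp (-l) := by
          rw [← Real.exp_add]; ring_nf
      _ ≤ Real.exp (-(k * -Real.log δ)) * (1 / 2) := by gcongr
      _ = _ := by ring

theorem card_pow_le_ncard_of_forall {s m : ℕ} {ε : ℝ} (hε : 0 < ε) (R : Finset (Fin s))
    (P : (Fin m → Fin s) → Prop) (h : ∀ i : Fin m → Fin s, (∀ t, i t ∈ R) → P i) :
    (1 - ε) * (R.card : ℝ) ^ m
      ≤ (({i : Fin m → Fin s | (∀ t, i t ∈ R) ∧ P i}.ncard : ℕ) : ℝ) := by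
  have : {i : Fin m → Fin s | (∀ t, i t ∈ R) ∧ P i}
      = ((Fintype.piFinset fun _ : Fin m => R : Finset (Fin m → Fin s)) : Set (Fin m → Fin s)) := by
    ext i
    simpa [Fintype.mem_piFinset] using h i
  rw [this, Set.ncard_coe_finset, Fintype.card_piFinset_const]
  push_cast
  have : 0 ≤ ε * (R.card : ℝ) ^ m := by positivity
  linarith

theorem mainTheorem1 (p : ℕ) [Fact p.Prime] (m : ℕ) (hm : 2 ≤ m) (δ ν ε : ℝ)
    (hδ : 0 < δ) (hν : 0 < ν) (hε : 0 < ε) :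
    ∃ C : ℝ, 0 < C ∧
      ∀ (n s : ℕ), 0 < s →
        ∀ A : Fin s → Finset (Cube n),
          (∀ i, (A i).Nonempty) →
          (∀ i, δ ≤ ((A i).dens : ℝ)) →
          ∃ R : Finset (Fin s),
            (s : ℝ) / ((n : ℝ) + 1) ^ C ≤ (R.card : ℝ) ∧
            (1 - ε) * (R.card : ℝ) ^ m ≤
              (({i : Fin m → Fin s | (∀ t, i t ∈ R) ∧
                ∀ φ : ModForm p n, -ν ≤ formCorrelation (fun t => A (i t)) φ}.ncard : ℕ) : ℝ) := by
  have hp : (0 : ℝ) < p := by exact_mod_cast (Fact.out : p.Prime).pos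
  have hm0 : (0 : ℝ) < m := by exact_mod_cast (by omega : 0 < m)
  obtain ⟨θ, hθ0, hθ1, hθ⟩ := exists_norm_one_add_stdAddChar_le p
  set d : ℝ := min δ 1 with hd
  have hd0 : 0 < d := lt_min hδ one_pos
  set η : ℝ := min (ν / (p * m)) 1 with hη
  have hη0 : 0 < η := lt_min (by positivity) one_pos
  have hη1 : η ≤ 1 := min_le_right _ _
  have hην : (p : ℝ) * (m * η) ≤ ν := by
    have := min_le_left (ν / (p * m)) 1
    rw [← hη, le_div_iff₀ (by positivity)] at this
    linarith
  obtain ⟨L, hL⟩ := exists_pow_lt_of_lt_one (by positivity : 0 < d * η ^ 2 / 2) hθ1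
  -- One `p` comes from the bound on biased forms, the other from the values `y` in the union bound;
  -- the `2` makes the failure probability at most `1/2`.
  obtain ⟨C, hC, hCk⟩ := exists_sample_size d η (2 * p * p * (2 / (d * η ^ 2) * Real.exp p)) hd0
    (min_le_right _ _) hη0 L
  refine ⟨C, hC, fun n s _ A hne hdens => ?_⟩
  have hform : ∀ φ : ModForm p n, ∃ c : Fin n → ZMod p, ∀ v, φ v = ∑ z, c z * v z := fun φ =>
    ⟨_, fun v => (LinearMap.pi_apply_eq_sum_univ φ v).trans
      (Finset.sum_congr rfl fun z _ => by rw [smul_eq_mul, mul_comm])⟩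
  -- For `n = 0` the bound demands all of `[s]`; every set is then the one-point cube, so all laws
  -- coincide and `η = 0` is allowed.
  rcases Nat.eq_zero_or_pos n with rfl | hn
  · refine ⟨Finset.univ, by simp, card_pow_le_ncard_of_forall hε _ _ fun i _ φ => ?_⟩
    have hA : ∀ i, A i = Finset.univ := fun i => by
      obtain ⟨a, ha⟩ := hne i
      exact Finset.eq_univ_of_forall fun b => Subsingleton.elim a b ▸ ha
    have := neg_le_correlation (by omega : 0 < m)
      (fun t => distOn (A (i t)) fun x => φ (x.toZMod p)) (fun _ _ => distOn_nonneg _ _ _)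
      (fun _ _ => distOn_le_one _ _ _) (distOn Finset.univ fun x : Cube 0 => φ (x.toZMod p))
      (fun _ => distOn_nonneg _ _ _) (sum_distOn Finset.univ_nonempty _) le_rfl
      (fun t => Or.inl fun y => by rw [hA, sub_zero])
    rw [mul_zero, mul_zero, neg_zero] at this
    unfold formCorrelation
    linarith
  · have hAd : ∀ i, d * 2 ^ n ≤ ((A i).card : ℝ) := fun i => by
      have h1 := (min_le_left δ 1).trans (hdens i)
      rw [Finset.nnratCast_dens, le_div_iff₀ (by positivity)] at h1
      simpa using h1
    obtain ⟨k, hk, hk1, hk2⟩ := hCk n hn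
    obtain ⟨x, R, hR, hgood⟩ := exists_common_sample (p := p) A hd0 hAd hη0 hη1 hk fun i => by
      have := mul_le_mul_of_nonneg_right (mul_le_mul_of_nonneg_right
        (card_biasedForms_le hθ0 hθ1 hθ hd0 hη0 (hAd i) hL.le) hp.le)
        (Real.exp_pos (-(k * η ^ 2 / 4))).le
      linarith
    refine ⟨R, ?_, card_pow_le_ncard_of_forall hε _ _ fun i hi φ => ?_⟩
    · refine le_trans ?_ hR
      rw [div_eq_mul_one_div]
      gcongr
    · obtain ⟨c, hc⟩ := hform φ
      have : Nonempty (Fin k) := ⟨⟨0, hk⟩⟩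
      unfold formCorrelation
      simp only [hc]
      refine le_trans ?_ (neg_le_correlation (by omega : 0 < m)
        (fun t => distOn (A (i t)) fun x => ∑ z, c z * x.toZMod p z) (fun _ _ => distOn_nonneg _ _ _)
        (fun _ _ => distOn_le_one _ _ _)
        (distOn Finset.univ fun j => ∑ z, c z * (x j).toZMod p z)
        (fun _ => distOn_nonneg _ _ _) (sum_distOn Finset.univ_nonempty _) hη0.le fun t => ?_)
      · rw [ZMod.card]; linarith
      · by_cases hb : c ∈ biasedForms p (A (i t)) η
        · exact Or.inl fun y => hgood _ (hi t) c hb y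
        · right
          intro y
          rw [ZMod.card]
          by_contra hy
          exact hb (Finset.mem_filter.mpr ⟨Finset.mem_univ _, y, not_le.mp hy⟩)
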